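/- Let $\mathbb{D}=\{z\in\mathbb{C}:|z|<1\}$. For functions $f,g$ analytic in $\mathbb{D}$ write $f\prec g$ ($f$ is subordinate to $g$) if there is an analytic $w:\mathbb{D}\to\mathbb{D}$ with $w(0)=0$ and $f(z)=g(w(z))$ for all $z\in\mathbb{D}$. Let $\mathcal{A}_0$ be the set of functions $p$ analytic in $\mathbb{D}$ with $p(0)=1$, and put $\wp(z)=1+ze^z$, $k=1+\sqrt2$. Let $0<\alpha<1$ and $0<B<A<1$, and take principal branches of the square roots. For each of the following pairs $(h,\beta_0)$: 1. $h(z)=\phi_0(z)=1+\dfrac{z}{k}\cdot\dfrac{k+z}{k-z}$, $\quad\beta_0=\dfrac{e}{k}\left(-1+2k\log\left(1+\dfrac1k\right)\right)$; 2. $h(z)=\sqrt{1+z}$, $\quad\beta_0=2e(1-\log 2)$; 3. $h(z)=1+\dfrac{z}{1-\alpha z^2}$, $\quad\beta_0=\dfrac{e}{2\sqrt\alpha}\log\dfrac{1+\sqrt\alpha}{1-\sqrt\alpha}$; 4. $h(z)=\dfrac{1+Az}{1+Bz}$, $\quad\beta_0=\max\left\{\dfrac{e(A-B)}{B}\log\dfrac{1}{1-B},\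 \dfrac{A-B}{eB}\log(1+B)\right\}$; 5. $h(z)=1+\sin z$, $\quad\beta_0=e\displaystyle\sum_{n=0}^{\infty}\frac{(-1)^n}{(2n+1)!\,(2n+1)}$; 6. $h(z)=z+\sqrt{1+z^2}$, $\quad\beta_0=e\left(3-k+\log\dfrac k2\right)$; 7. $h(z)=e^z$, $\quad\beta_0=e\displaystyle\sum_{n=1}^{\infty}\frac{(-1)^{n+1}}{n!\,n}$; the following holds. For every real $\beta\ge\beta_0$ and every $p\in\mathcal{A}_0$, $$1+\beta zp'(z)\prec h(z)\quad\Longrightarrow\quad p\prec\wp .$$ The bound $\beta_0$ is sharp: for every real $\beta$ with $0<\beta<\beta_0$ there is a $p\in\mathcal{A}_0$ with $1+\beta zp'(z)\prec h(z)$ but $p\not\prec\wp$. -/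

import Mathlib

namespace CardioidSubordination

/-- The open unit disk of the complex plane. -/
def unitDisk : Set ℂ := Metric.ball 0 1

/-- Schwarz functions: analytic self-maps of the unit disk that fix the origin.
Only the values on the disk matter. -/
structure IsSchwarz (w : ℂ → ℂ) : Prop where
  analytic : AnalyticOnNhd ℂ w unitDisk
  mapsTo : Set.MapsTo w unitDisk unitDisk
  map_zero : w 0 = 0

/-- Subordination `f ≺ g` in the unit disk: `f = g ∘ w` on the disk for a Schwarz function `w`. -/
def Subordinate (f g : ℂ → ℂ) : Prop :=
  ∃ w : ℂ → ℂ, IsSchwarz w ∧ ∀ z ∈ unitDisk, f z = g (w z)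

/-- The class of functions analytic in the unit disk with value `1` at the origin. -/
def classA0 : Set (ℂ → ℂ) := {p | AnalyticOnNhd ℂ p unitDisk ∧ p 0 = 1}

/-- The differential expression `1 + β z p'(z)`. -/
noncomputable def diffExpr (β : ℝ) (p : ℂ → ℂ) (z : ℂ) : ℂ := 1 + (β : ℂ) * z * deriv p z

/-- The cardioid function `1 + z e^z`. -/
noncomputable def cardioid (z : ℂ) : ℂ := 1 + z * Complex.exp z

/-- The constant `k = 1 + √2`. -/
noncomputable def k : ℝ := 1 + Real.sqrt 2

/-- The rational function `1 + (z / k) ((k + z) / (k - z))`. -/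
noncomputable def phi0 (z : ℂ) : ℂ := 1 + z / (k : ℂ) * (((k : ℂ) + z) / ((k : ℂ) - z))

/-- Every `p` in the class with `1 + β z p'(z) ≺ h` satisfies `p ≺ 1 + z e^z`. -/
def Implication (h : ℂ → ℂ) (β : ℝ) : Prop :=
  ∀ p ∈ classA0, Subordinate (diffExpr β p) h → Subordinate p cardioid

/-- The implication holds for every `β ≥ β₀`, and the bound is sharp: it fails for every
positive `β < β₀`. -/
def HoldsWithSharpBound (h : ℂ → ℂ) (β₀ : ℝ) : Prop :=
  (∀ β : ℝ, β₀ ≤ β → Implication h β) ∧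
    ∀ β : ℝ, 0 < β → β < β₀ → ¬ Implication h β

end CardioidSubordination

namespace CardioidSubordination
open Complex Filter Topology


/-! Since z e^z is univalent on the disk, p ≺ 1 + z e^z only asks that p - 1 take its values in the
image of z e^z. That image contains the region |u| < 1, Re u > -1/e: on the unit circle |ζ e^ζ| ≥ 1
when Re ζ ≥ 0, and Re(ζ e^ζ) ≤ -1/e when Re ζ ≤ 0. It contains no real number below -1/e.

Let P = β(p - 1), so that z P'(z) = h(w(z)) - 1 with |w(z)| ≤ |z|, and let Ψ(r) be the integral of
(1 - h(-t))/t over [0, r]. At a maximum of Re(-P) on a circle the angular derivative vanishes, so z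
P' is real there. Hence h only has to be bounded below where it is real, and there h(w) ≥ h(-r) for
|w| ≤ r. This gives Re P ≥ -Ψ(|z|) > -Ψ(1) (`re_le_of_real_radial_deriv_le`), so β ≥ e Ψ(1) forces
Re(p - 1) > -1/e. A cruder majorant Φ of |P| with Φ(1) ≤ e Ψ(1) gives |p - 1| < 1.

Conversely, if z G' = h - 1 and G(0) = 0, then p = 1 + G/β has p(-r) - 1 = -Ψ(r)/β, which drops
below -1/e for r near 1 as soon as β < e Ψ(1). So β₀ = e Ψ(1)
(`holdsWithSharpBound_of_radial_bounds`). Each of the seven cases supplies Ψ, Φ and the bounds on h.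
-/

theorem isOpen_unitDisk : IsOpen unitDisk := Metric.isOpen_ball

theorem mem_unitDisk {z : ℂ} : z ∈ unitDisk ↔ ‖z‖ < 1 := by simp [unitDisk]

/-! ### Univalence of z e^z and lifting through it -/

/-- With d = x + iy and E = e^(-x) ≤ 1, the squared left side is (1 - E)² + 2E(1 - cos y) ≤ x² + y².
-/
theorem norm_exp_neg_sub_one_le {d : ℂ} (hd : 0 ≤ d.re) : ‖exp (-d) - 1‖ ≤ ‖d‖ := by
  have h1 : 1 - d.re ≤ Real.exp (-d.re) := by linarith [Real.add_one_le_exp (-d.re)]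
  have h2 : Real.exp (-d.re) ≤ 1 := Real.exp_le_one_iff.2 (by linarith)
  have h3 := Real.one_sub_sq_div_two_le_cos (x := d.im)
  have h4 := Real.sin_sq_add_cos_sq d.im
  have h5 := Real.cos_le_one d.im
  refine le_of_sq_le_sq ?_ (norm_nonneg _)
  rw [← normSq_eq_norm_sq, ← normSq_eq_norm_sq, normSq_apply, normSq_apply]
  simp only [sub_re, sub_im, exp_re, exp_im, neg_re, neg_im, Real.cos_neg, Real.sin_neg, one_re,
    one_im]
  set E := Real.exp (-d.re)
  have hE : 0 < E := Real.exp_pos _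
  have h6 : (1 - E) ^ 2 ≤ d.re ^ 2 := by nlinarith
  have h7 : 2 * E * (1 - Real.cos d.im) ≤ d.im ^ 2 := by nlinarith
  nlinarith

/-- The equation rewrites as w - z = z (e^(-(w - z)) - 1), so |w - z| ≤ |z| |w - z|, which forces w
= z. The half-plane condition costs nothing, since the roles of z and w can be exchanged. -/
theorem mul_exp_injective_aux {z w : ℂ} (hz : ‖z‖ < 1) (h : z * exp z = w * exp w)
    (hre : 0 ≤ (w - z).re) : z = w := by
  by_contra hne
  have hd : 0 < ‖w - z‖ := norm_pos_iff.2 (sub_ne_zero.2 (Ne.symm hne))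
  have h1 : w - z = z * (exp (-(w - z)) - 1) := by
    have h2 : exp (-(w - z)) = exp z * (exp w)⁻¹ := by rw [← exp_neg, ← exp_add]; ring_nf
    have h3 := exp_ne_zero w
    rw [h2, mul_sub, ← mul_assoc, h]
    field_simp
  have h4 : ‖w - z‖ ≤ ‖z‖ * ‖w - z‖ := by
    conv_lhs => rw [h1, norm_mul]
    gcongr
    exact norm_exp_neg_sub_one_le hre
  nlinarith

theorem injOn_mul_exp : Set.InjOn (fun z : ℂ => z * exp z) unitDisk := by
  intro z hz w hw h
  rcases le_total 0 (w - z).re with hre | hre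
  · exact mul_exp_injective_aux (mem_unitDisk.1 hz) h hre
  · refine (mul_exp_injective_aux (mem_unitDisk.1 hw) h.symm ?_).symm
    rw [sub_re] at hre ⊢
    linarith

theorem exists_local_inverse_mul_exp {z : ℂ} (hz : z ∈ unitDisk) :
    ∃ g : ℂ → ℂ, DifferentiableAt ℂ g (z * exp z) ∧ g (z * exp z) = z ∧
      ∀ᶠ u in 𝓝 (z * exp z), g u * exp (g u) = u := by
  have hd : HasStrictDerivAt (fun z : ℂ => z * exp z) (1 * exp z + z * exp z) z :=
    (hasStrictDerivAt_id z).mul (hasStrictDerivAt_exp z)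
  have hne : 1 * exp z + z * exp z ≠ 0 := by
    rw [← add_mul]
    refine mul_ne_zero (fun h0 => ?_) (exp_ne_zero z)
    have : z = -1 := by linear_combination h0
    rw [mem_unitDisk, this] at hz
    simp at hz
  refine ⟨hd.localInverse _ _ _ hne, (hd.to_localInverse hne).hasDerivAt.differentiableAt, ?_, ?_⟩
  · exact (hd.hasStrictFDerivAt_equiv hne).localInverse_apply_image
  · exact (hd.hasStrictFDerivAt_equiv hne).eventually_right_inverse

theorem isOpen_image_mul_exp : IsOpen ((fun z : ℂ => z * exp z) '' unitDisk) := by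
  rw [isOpen_iff_mem_nhds]
  rintro _ ⟨z, hz, rfl⟩
  obtain ⟨g, hg, hgz, hu⟩ := exists_local_inverse_mul_exp hz
  have : ∀ᶠ u in 𝓝 (z * exp z), g u ∈ unitDisk :=
    hg.continuousAt.eventually_mem (by rw [hgz]; exact isOpen_unitDisk.mem_nhds hz)
  filter_upwards [hu, this] with u h1 h2
  exact ⟨g u, h2, h1⟩

/-- A function of the class whose range lies in the range of the univalent cardioid function is
subordinate to it. -/
theorem subordinate_cardioid_of_mapsTo {p : ℂ → ℂ} (hp : p ∈ classA0)
    (h : ∀ z ∈ unitDisk, ∃ w ∈ unitDisk, w * exp w = p z - 1) : Subordinate p cardioid := by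
  choose! w hw hwp using h
  have h0 : (0 : ℂ) ∈ unitDisk := by simp [mem_unitDisk]
  refine ⟨w, ⟨?_, hw, ?_⟩, fun z hz => by rw [cardioid, hwp z hz]; ring⟩
  · refine DifferentiableOn.analyticOnNhd (fun z hz => ?_) isOpen_unitDisk
    obtain ⟨g, hg, hgz, hu⟩ := exists_local_inverse_mul_exp (hw z hz)
    rw [hwp z hz] at hg hgz hu
    have hpd : DifferentiableAt ℂ (fun x => p x - 1) z :=
      ((hp.1 z hz).differentiableAt).sub_const 1
    have hc : DifferentiableAt ℂ (fun x => g (p x - 1)) z :=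
      DifferentiableAt.comp z hg hpd
    have h1 : ∀ᶠ x in 𝓝 z, g (p x - 1) ∈ unitDisk :=
      hc.continuousAt.eventually_mem (by rw [hgz]; exact isOpen_unitDisk.mem_nhds (hw z hz))
    have h2 := hpd.continuousAt.eventually hu
    refine (hc.congr_of_eventuallyEq ?_).differentiableWithinAt
    filter_upwards [h1, h2, isOpen_unitDisk.mem_nhds hz] with x h1 h2 h3
    -- The pointwise choice w is not known to be continuous; injectivity makes it agree near z with
    -- the analytic local inverse applied to p - 1.
    refine injOn_mul_exp (hw x h3) h1 ?_
    exact (hwp x h3).trans h2.symm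
  · refine injOn_mul_exp (hw 0 h0) h0 ?_
    simp only [hwp 0 h0, hp.2]
    simp

/-- The image of the open disk is open and that of the closed disk is compact. A connected set
containing 0 and avoiding the image of the circle is covered by the first and the complement of the
second, so it stays in the first. -/
theorem subordinate_cardioid_of_avoids_boundary {p : ℂ → ℂ} (hp : p ∈ classA0)
    (h : ∀ z ∈ unitDisk, ∀ ζ : ℂ, ‖ζ‖ = 1 → ζ * exp ζ ≠ p z - 1) : Subordinate p cardioid := by
  refine subordinate_cardioid_of_mapsTo hp ?_
  have h0 : (0 : ℂ) ∈ unitDisk := by simp [mem_unitDisk]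
  have hcont : Continuous fun z : ℂ => z * exp z := by fun_prop
  have hS : IsPreconnected ((fun z => p z - 1) '' unitDisk) :=
    (convex_ball (0 : ℂ) 1).isPreconnected.image _
      (hp.1.continuousOn.sub continuousOn_const)
  have hK : IsClosed ((fun z : ℂ => z * exp z) '' Metric.closedBall 0 1) :=
    ((isCompact_closedBall 0 1).image hcont).isClosed
  have hsub := hS.subset_left_of_subset_union isOpen_image_mul_exp hK.isOpen_compl ?_ ?_ ?_
  · intro z hz
    exact hsub ⟨z, hz, rfl⟩
  · rw [Set.disjoint_compl_right_iff_subset]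
    exact Set.image_mono Metric.ball_subset_closedBall
  · rintro _ ⟨z, hz, rfl⟩
    by_cases hmem : p z - 1 ∈ (fun z : ℂ => z * exp z) '' Metric.closedBall 0 1
    · obtain ⟨ζ, hζ, hζp⟩ := hmem
      left
      refine ⟨ζ, ?_, hζp⟩
      rw [mem_closedBall_zero_iff] at hζ
      exact mem_unitDisk.2 (lt_of_le_of_ne hζ fun h1 => h z hz ζ h1 hζp)
    · exact Or.inr hmem
  · exact ⟨0, ⟨0, h0, by simp [hp.2]⟩, ⟨0, h0, by simp⟩⟩

/-! ### A region inside the image of z e^z -/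

/-- For ζ = -c - is this is Re(ζ e^ζ) ≤ -1/e multiplied by -e^c. Both sides are compared with
polynomials in c through Taylor bounds and s² = 1 - c²; equality holds at c = 1. -/
theorem exp_sub_one_le_of_sq_add_sq {c s : ℝ} (hc : 0 ≤ c) (h : c ^ 2 + s ^ 2 = 1) :
    Real.exp (c - 1) ≤ c * Real.cos s + s * Real.sin s := by
  have hc1 : c ≤ 1 := by nlinarith
  have h1 : Real.exp (c - 1) ≤ (1 + c ^ 2) / 2 := by
    have h2 := Real.quadratic_le_exp_of_nonneg (x := 1 - c) (by linarith)
    have h3 : Real.exp (c - 1) = (Real.exp (1 - c))⁻¹ := by rw [← Real.exp_neg]; ring_nf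
    rw [h3, inv_le_comm₀ (Real.exp_pos _) (by positivity)]
    refine le_trans ?_ h2
    rw [inv_le_iff_one_le_mul₀ (by positivity)]
    nlinarith [mul_nonneg (mul_nonneg hc (sub_nonneg.2 hc1)) (sq_nonneg (1 - c)),
      mul_nonneg (sub_nonneg.2 hc1) (sq_nonneg (1 - c)), pow_nonneg (sub_nonneg.2 hc1) 4]
  have h2 : 1 - s ^ 2 / 2 ≤ Real.cos s := Real.one_sub_sq_div_two_le_cos
  have h3 : s ^ 2 - s ^ 4 / 6 ≤ s * Real.sin s := by
    rcases le_total 0 s with hs | hs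
    · nlinarith [Real.sin_ge_sub_cube hs]
    · have := Real.sin_ge_sub_cube (x := -s) (by linarith)
      rw [Real.sin_neg] at this
      nlinarith
  have h4 : s ^ 2 = 1 - c ^ 2 := by linarith
  have h5 : s ^ 4 = (1 - c ^ 2) ^ 2 := by rw [← h4]; ring
  rw [h5, h4] at h3
  rw [h4] at h2
  -- Six times the gap between the polynomial lower bound for the right side and (1 + c²)/2.
  have h6 : 0 ≤ (1 - c) * (2 + 5 * c - 2 * c ^ 2 + c ^ 3) := by
    refine mul_nonneg (by linarith) ?_
    nlinarith [pow_nonneg hc 3]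
  nlinarith [mul_le_mul_of_nonneg_left h2 hc]

theorem re_mul_exp_le_of_norm_eq_one {ζ : ℂ} (h : ‖ζ‖ = 1) (hre : ζ.re ≤ 0) :
    (ζ * exp ζ).re ≤ -Real.exp (-1) := by
  have h1 : (-ζ.re) ^ 2 + (-ζ.im) ^ 2 = 1 := by
    have := normSq_eq_norm_sq ζ
    rw [h, normSq_apply] at this
    linarith
  have h2 := exp_sub_one_le_of_sq_add_sq (neg_nonneg.2 hre) h1
  rw [Real.cos_neg, Real.sin_neg] at h2
  have h3 : (ζ * exp ζ).re
      = -(Real.exp ζ.re * (-ζ.re * Real.cos ζ.im + -ζ.im * -Real.sin ζ.im)) := by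
    rw [mul_re, exp_re, exp_im]; ring
  have h4 : Real.exp (-1) = Real.exp ζ.re * Real.exp (-ζ.re - 1) := by
    rw [← Real.exp_add]; ring_nf
  rw [h3, h4]
  exact neg_le_neg (mul_le_mul_of_nonneg_left h2 (Real.exp_pos _).le)

theorem one_le_norm_mul_exp_of_norm_eq_one {ζ : ℂ} (h : ‖ζ‖ = 1) (hre : 0 ≤ ζ.re) :
    1 ≤ ‖ζ * exp ζ‖ := by
  rw [norm_mul, h, norm_exp, one_mul]
  exact Real.one_le_exp hre

theorem subordinate_cardioid_of_norm_lt_of_re_gt {p : ℂ → ℂ} (hp : p ∈ classA0)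
    (hnorm : ∀ z ∈ unitDisk, ‖p z - 1‖ < 1)
    (hre : ∀ z ∈ unitDisk, -Real.exp (-1) < (p z - 1).re) : Subordinate p cardioid := by
  refine subordinate_cardioid_of_avoids_boundary hp fun z hz ζ hζ heq => ?_
  rcases le_total 0 ζ.re with h | h
  · have := one_le_norm_mul_exp_of_norm_eq_one hζ h
    rw [heq] at this
    exact (hnorm z hz).not_ge this
  · have := re_mul_exp_le_of_norm_eq_one hζ h
    rw [heq] at this
    exact (hre z hz).not_ge this

/-- Real values of `z e^z` in the unit disk are at least `-1/e`. -/
theorem neg_exp_neg_one_le_of_mul_exp_real {z : ℂ} (hz : z ∈ unitDisk) {x : ℝ}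
    (h : z * exp z = x) : -Real.exp (-1) ≤ x := by
  have hz' := mem_unitDisk.1 hz
  -- z and its conjugate have the same real image, so by injectivity z is real; then y e^y ≥ -1/e
  -- follows from e^(-y-1) ≥ -y.
  have hconj : (starRingEnd ℂ) z * exp ((starRingEnd ℂ) z) = z * exp z := by
    rw [exp_conj, ← map_mul, h, conj_ofReal]
  have hreal : (starRingEnd ℂ) z = z :=
    injOn_mul_exp (mem_unitDisk.2 (by rwa [norm_conj])) hz hconj
  obtain ⟨y, rfl⟩ := conj_eq_iff_real.1 hreal
  have h1 : y * Real.exp y = x := by exact_mod_cast h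
  have h2 := Real.add_one_le_exp (-y - 1)
  have h3 : Real.exp (-y - 1) * Real.exp y = Real.exp (-1) := by
    rw [← Real.exp_add]; ring_nf
  nlinarith [Real.exp_pos y]


/-! ### Radial comparison principle -/

theorem deriv_nonneg_of_left_max {u : ℝ → ℝ} {u' : ℝ} (hu : HasDerivAt u u' 1)
    (hmax : ∀ t ∈ Set.Ioo (0 : ℝ) 1, u t ≤ u 1) : 0 ≤ u' := by
  have h1 := (hasDerivAt_iff_tendsto_slope_left_right.1 hu).1
  refine ge_of_tendsto h1 ?_
  filter_upwards [Ioo_mem_nhdsLT (zero_lt_one' ℝ)] with t ht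
  rw [slope_def_field]
  exact div_nonneg_of_nonpos (sub_nonpos.2 (hmax t ht)) (by linarith [ht.2])

/-- If `z P'(z)` is at most `‖z‖ ψ(‖z‖)` wherever it is real, then `Re P` is dominated by the
primitive of `ψ`. -/
theorem re_le_of_real_radial_deriv_le {P : ℂ → ℂ} (hP : AnalyticOnNhd ℂ P unitDisk)
    (h0 : P 0 = 0) {Ψ ψ : ℝ → ℝ} (hc : ContinuousOn Ψ (Set.Icc 0 1)) (hΨ0 : Ψ 0 = 0)
    (hΨ : ∀ r ∈ Set.Ioo (0 : ℝ) 1, HasDerivAt Ψ (ψ r) r)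
    (hb : ∀ z ∈ unitDisk, z ≠ 0 → (z * deriv P z).im = 0 →
      (z * deriv P z).re ≤ ‖z‖ * ψ ‖z‖) {z : ℂ} (hz : z ∈ unitDisk) : (P z).re ≤ Ψ ‖z‖ := by
  refine le_of_forall_pos_le_add fun ε hε => ?_
  have hz1 := mem_unitDisk.1 hz
  -- The ε term makes the radial derivative of F strictly negative at a nonzero maximum point, which
  -- is the contradiction sought; a maximum at 0 gives the claim up to ε.
  set F : ℂ → ℝ := fun x => (P x).re - Ψ ‖x‖ - ε * ‖x‖ with hF
  have hsub : Metric.closedBall (0 : ℂ) ‖z‖ ⊆ unitDisk := Metric.closedBall_subset_ball hz1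
  have hFc : ContinuousOn F (Metric.closedBall 0 ‖z‖) := by
    refine ((continuous_re.comp_continuousOn (hP.continuousOn.mono hsub)).sub ?_).sub
      (by fun_prop)
    refine hc.comp continuous_norm.continuousOn fun x hx => ⟨norm_nonneg _, ?_⟩
    exact (mem_unitDisk.1 (hsub hx)).le
  obtain ⟨z₀, hz₀, hmax⟩ := (isCompact_closedBall (0 : ℂ) ‖z‖).exists_isMaxOn
    ⟨0, by simp⟩ hFc
  have hzmem : z ∈ Metric.closedBall (0 : ℂ) ‖z‖ := by simp
  have hFz : F z ≤ F z₀ := hmax hzmem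
  have hz₀1 := mem_unitDisk.1 (hsub hz₀)
  have hz₀n : ‖z₀‖ ≤ ‖z‖ := by simpa using hz₀
  by_cases hne : z₀ = 0
  · have : F z₀ = 0 := by simp [hF, hne, h0, hΨ0]
    have h1 : F z = (P z).re - Ψ ‖z‖ - ε * ‖z‖ := rfl
    nlinarith
  exfalso
  have hpos : 0 < ‖z₀‖ := norm_pos_iff.2 hne
  have hd : HasDerivAt P (deriv P z₀) z₀ := ((hP z₀ (hsub hz₀)).differentiableAt).hasDerivAt
  -- Rotating z₀ leaves the radial terms of F unchanged, so Re P is stationary along the circle at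
  -- z₀.
  have him : (z₀ * deriv P z₀).im = 0 := by
    have h1 : HasDerivAt (fun t : ℝ => z₀ * exp (t * I)) (z₀ * I) 0 := by
      have h2 : HasDerivAt (fun t : ℝ => (t : ℂ) * I) (1 * I) 0 :=
        (ofRealCLM.hasDerivAt (x := (0 : ℝ))).mul_const I
      simpa using (h2.cexp).const_mul z₀
    have h3 : HasDerivAt (fun t : ℝ => P (z₀ * exp (t * I))) (z₀ * I * deriv P z₀) 0 := by
      have hd' : HasDerivAt P (deriv P z₀) (z₀ * exp (((0 : ℝ) : ℂ) * I)) := by simpa using hd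
      exact (hd'.scomp (0 : ℝ) h1).congr_deriv (smul_eq_mul _ _)
    have h4 : HasDerivAt (fun t : ℝ => (P (z₀ * exp (t * I))).re) (z₀ * I * deriv P z₀).re 0 :=
      reCLM.hasFDerivAt.comp_hasDerivAt (0 : ℝ) h3
    have h5 : IsLocalMax (fun t : ℝ => (P (z₀ * exp (t * I))).re) 0 := by
      refine Eventually.of_forall fun t => ?_
      have hn : ‖z₀ * exp (t * I)‖ = ‖z₀‖ := by rw [norm_mul, norm_exp_ofReal_mul_I, mul_one]
      have h6 : F (z₀ * exp (t * I)) ≤ F z₀ := hmax (by simp [hz₀n])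
      simp only [hF, hn] at h6
      simp only [ofReal_zero, zero_mul, exp_zero, mul_one]
      linarith
    have h7 := h5.hasDerivAt_eq_zero h4
    have h8 : z₀ * I * deriv P z₀ = z₀ * deriv P z₀ * I := by ring
    rw [h8, mul_I_re] at h7
    linarith
  have hrad : HasDerivAt (fun t : ℝ => F (t * z₀))
      ((z₀ * deriv P z₀).re - ‖z₀‖ * ψ ‖z₀‖ - ε * ‖z₀‖) 1 := by
    have h1 : HasDerivAt (fun t : ℝ => (t : ℂ) * z₀) (1 * z₀) 1 :=
      (ofRealCLM.hasDerivAt (x := (1 : ℝ))).mul_const z₀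
    have h3 : HasDerivAt (fun t : ℝ => P (t * z₀)) (z₀ * deriv P z₀) 1 := by
      have hd' : HasDerivAt P (deriv P z₀) (((1 : ℝ) : ℂ) * z₀) := by simpa using hd
      exact (hd'.scomp (1 : ℝ) h1).congr_deriv (by rw [smul_eq_mul, one_mul])
    have h4 : HasDerivAt (fun t : ℝ => (P (t * z₀)).re) (z₀ * deriv P z₀).re 1 :=
      reCLM.hasFDerivAt.comp_hasDerivAt (1 : ℝ) h3
    have h5 : HasDerivAt (fun t : ℝ => t * ‖z₀‖) (1 * ‖z₀‖) 1 := (hasDerivAt_id _).mul_const _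
    have h6 : HasDerivAt (fun t : ℝ => Ψ (t * ‖z₀‖)) (ψ ‖z₀‖ * (1 * ‖z₀‖)) 1 := by
      refine HasDerivAt.comp (1 : ℝ) ?_ h5
      simpa using hΨ ‖z₀‖ ⟨hpos, hz₀1⟩
    have h7 := (h4.sub h6).sub (h5.const_mul ε)
    refine (h7.congr_of_eventuallyEq ?_).congr_deriv (by ring)
    filter_upwards [Ioi_mem_nhds (zero_lt_one' ℝ)] with t ht
    have hn : ‖(t : ℂ) * z₀‖ = t * ‖z₀‖ := by
      rw [norm_mul, norm_real, Real.norm_of_nonneg (le_of_lt ht)]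
    simp only [hF, hn, Pi.sub_apply]
  have hnonneg := deriv_nonneg_of_left_max hrad fun t ht => by
    have hn : ‖(t : ℂ) * z₀‖ = t * ‖z₀‖ := by
      rw [norm_mul, norm_real, Real.norm_of_nonneg ht.1.le]
    have : F (t * z₀) ≤ F z₀ := hmax (by
      rw [mem_closedBall_zero_iff, hn]
      nlinarith [ht.2])
    simpa using this
  have := hb z₀ (hsub hz₀) hne him
  nlinarith

theorem norm_le_of_forall_re_mul_le {x : ℂ} {C : ℝ}
    (h : ∀ c : ℂ, ‖c‖ = 1 → (c * x).re ≤ C) : ‖x‖ ≤ C := by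
  by_cases hx : x = 0
  · simpa [hx] using h 1 (by simp)
  have hn : ‖x‖ ≠ 0 := norm_ne_zero_iff.2 hx
  have h1 := h ((starRingEnd ℂ) x / ‖x‖)
    (by rw [norm_div, norm_conj, norm_real, norm_norm, div_self hn])
  rw [div_mul_eq_mul_div, mul_comm, mul_conj, normSq_eq_norm_sq, ← ofReal_div, ofReal_re] at h1
  rwa [pow_two, mul_div_assoc, div_self hn, mul_one] at h1

/-- If `‖z P'(z)‖ ≤ ‖z‖ φ(‖z‖)`, then `‖P‖` is dominated by the primitive of `φ`. -/
theorem norm_le_of_norm_radial_deriv_le {P : ℂ → ℂ} (hP : AnalyticOnNhd ℂ P unitDisk)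
    (h0 : P 0 = 0) {Φ φ : ℝ → ℝ} (hc : ContinuousOn Φ (Set.Icc 0 1)) (hΦ0 : Φ 0 = 0)
    (hΦ : ∀ r ∈ Set.Ioo (0 : ℝ) 1, HasDerivAt Φ (φ r) r)
    (hb : ∀ z ∈ unitDisk, z ≠ 0 → ‖z * deriv P z‖ ≤ ‖z‖ * φ ‖z‖) {z : ℂ} (hz : z ∈ unitDisk) :
    ‖P z‖ ≤ Φ ‖z‖ := by
  refine norm_le_of_forall_re_mul_le fun c hc1 => ?_
  refine re_le_of_real_radial_deriv_le (P := fun x => c * P x)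
    (fun x hx => analyticAt_const.mul (hP x hx)) (by simp [h0]) hc hΦ0 hΦ
    (fun x hx hx0 _ => ?_) hz
  rw [deriv_const_mul _ (hP x hx).differentiableAt]
  refine (re_le_norm _).trans ((le_of_eq ?_).trans (hb x hx hx0))
  rw [mul_left_comm, norm_mul, hc1, one_mul]

/-! ### The extremal function and the general sharpness criterion -/

theorem lt_value_at_one {Ψ ψ : ℝ → ℝ} (hc : ContinuousOn Ψ (Set.Icc 0 1))
    (hΨ : ∀ r ∈ Set.Ioo (0 : ℝ) 1, HasDerivAt Ψ (ψ r) r) (hpos : ∀ r ∈ Set.Ioo (0 : ℝ) 1, 0 < ψ r)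
    {r : ℝ} (h0 : 0 ≤ r) (h1 : r < 1) : Ψ r < Ψ 1 := by
  have := strictMonoOn_of_deriv_pos (convex_Icc (0 : ℝ) 1) hc fun x hx => by
    rw [interior_Icc] at hx
    rw [(hΨ x hx).deriv]
    exact hpos x hx
  exact this ⟨h0, h1.le⟩ ⟨zero_le_one, le_rfl⟩ h1

/-- On the disk, `h - 1 = z G'` for an analytic function `G`. -/
theorem exists_radial_primitive {h : ℂ → ℂ} (hh : AnalyticOnNhd ℂ h unitDisk) (h0 : h 0 = 1) :
    ∃ G : ℂ → ℂ, AnalyticOnNhd ℂ G unitDisk ∧ G 0 = 0 ∧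
      ∀ z ∈ unitDisk, z * deriv G z = h z - 1 := by
  -- (h(z) - 1)/z has a removable singularity at 0, and an analytic function on a disk has a
  -- primitive.
  have hd : DifferentiableOn ℂ (dslope h 0) unitDisk :=
    (differentiableOn_dslope (isOpen_unitDisk.mem_nhds (by simp [mem_unitDisk]))).2
      hh.differentiableOn
  obtain ⟨G, hG0, hG⟩ := hd.isExactOn_ball.with_val_at 0 0
  refine ⟨G, DifferentiableOn.analyticOnNhd
    (fun z hz => (hG z hz).differentiableAt.differentiableWithinAt) isOpen_unitDisk, hG0, ?_⟩
  intro z hz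
  rw [(hG z hz).deriv]
  have := sub_smul_dslope h 0 z
  rwa [sub_zero, smul_eq_mul, h0] at this

/-- Along the negative radius, a radial primitive is equal to `-Ψ`. -/
theorem radial_primitive_neg {G h : ℂ → ℂ} (hG : AnalyticOnNhd ℂ G unitDisk) (hG0 : G 0 = 0)
    (hGd : ∀ z ∈ unitDisk, z * deriv G z = h z - 1)
    {Ψ ψ : ℝ → ℝ} (hc : ContinuousOn Ψ (Set.Icc 0 1)) (hΨ0 : Ψ 0 = 0)
    (hΨ : ∀ r ∈ Set.Ioo (0 : ℝ) 1, HasDerivAt Ψ (ψ r) r)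
    (hneg : ∀ r : ℝ, r ∈ Set.Ioo (0 : ℝ) 1 → h (-r) = 1 - r * ψ r)
    {r : ℝ} (hr : 0 < r) (h1 : r < 1) : G (-r) = -(Ψ r : ℂ) := by
  have hmem : ∀ t ∈ Set.Icc 0 r, -(t : ℂ) ∈ unitDisk := fun t ht => by
    rw [mem_unitDisk, norm_neg, norm_real, Real.norm_of_nonneg ht.1]
    exact ht.2.trans_lt h1
  have hcont : ContinuousOn (fun t : ℝ => G (-t) + (Ψ t : ℂ)) (Set.Icc 0 r) := by
    refine ContinuousOn.add (hG.continuousOn.comp (by fun_prop) hmem) ?_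
    exact continuous_ofReal.comp_continuousOn (hc.mono (Set.Icc_subset_Icc_right h1.le))
  have hder : ∀ t ∈ Set.Ioo 0 r, HasDerivAt (fun t : ℝ => G (-t) + (Ψ t : ℂ)) 0 t := by
    intro t ht
    have hm := hmem t ⟨ht.1.le, ht.2.le⟩
    have ht1 : t ∈ Set.Ioo (0 : ℝ) 1 := ⟨ht.1, ht.2.trans h1⟩
    have ht0 : (t : ℂ) ≠ 0 := ofReal_ne_zero.2 ht.1.ne'
    have hd : deriv G (-t) = ψ t := by
      have h2 := hGd _ hm
      rw [hneg t ht1] at h2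
      have h3 : (t : ℂ) * deriv G (-t) = t * ψ t := by linear_combination -h2
      exact mul_left_cancel₀ ht0 h3
    have h2 : HasDerivAt (fun t : ℝ => -(t : ℂ)) (-1) t :=
      (ofRealCLM.hasDerivAt (x := t)).neg
    have h3 : HasDerivAt (fun t : ℝ => G (-t)) ((-1 : ℂ) • deriv G (-t)) t :=
      ((hG _ hm).differentiableAt.hasDerivAt).scomp t h2
    refine (h3.add (hΨ t ht1).ofReal_comp).congr_deriv ?_
    rw [hd]
    simp
  -- The mean value theorem is real, so it is applied to Re(c ·) for each unit c.
  have hz : ‖G (-r) + (Ψ r : ℂ)‖ ≤ 0 := by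
    refine norm_le_of_forall_re_mul_le fun c _ => ?_
    have hder' : ∀ t ∈ Set.Ioo 0 r,
        HasDerivAt (fun t : ℝ => (c * (G (-t) + (Ψ t : ℂ))).re) 0 t := fun t ht => by
      exact (reCLM.hasFDerivAt.comp_hasDerivAt t ((hder t ht).const_mul c)).congr_deriv (by simp)
    obtain ⟨t, ht, hts⟩ := exists_hasDerivAt_eq_slope
      (fun t : ℝ => (c * (G (-t) + (Ψ t : ℂ))).re) _ hr
      (continuous_re.comp_continuousOn (continuousOn_const.mul hcont)) hder'
    have h5 := (div_eq_zero_iff.1 hts.symm).resolve_right (by linarith)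
    simp only [ofReal_zero, neg_zero, hG0, hΨ0, add_zero, mul_zero, zero_re, sub_zero] at h5
    exact h5.le
  exact eq_neg_of_add_eq_zero_left (norm_le_zero_iff.1 hz)

/-- Sufficient conditions for the sharp implication: `Ψ` is (minus) the radial primitive of
`h - 1` along the negative radius, and `Φ` dominates it in modulus. -/
theorem holdsWithSharpBound_of_radial_bounds {h : ℂ → ℂ} (hh : AnalyticOnNhd ℂ h unitDisk)
    (h0 : h 0 = 1) (Ψ ψ Φ φ : ℝ → ℝ) {β₀ : ℝ} (hβ₀ : β₀ = Real.exp 1 * Ψ 1)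
    (hΨc : ContinuousOn Ψ (Set.Icc 0 1)) (hΨ0 : Ψ 0 = 0)
    (hΨ : ∀ r ∈ Set.Ioo (0 : ℝ) 1, HasDerivAt Ψ (ψ r) r)
    (hψ : ∀ r ∈ Set.Ioo (0 : ℝ) 1, 0 < ψ r)
    (hneg : ∀ r : ℝ, r ∈ Set.Ioo (0 : ℝ) 1 → h (-r) = 1 - r * ψ r)
    (hreal : ∀ w ∈ unitDisk, (h w).im = 0 → ∀ r ∈ Set.Ioo (0 : ℝ) 1, ‖w‖ ≤ r →
      1 - r * ψ r ≤ (h w).re)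
    (hΦc : ContinuousOn Φ (Set.Icc 0 1)) (hΦ0 : Φ 0 = 0)
    (hΦ : ∀ r ∈ Set.Ioo (0 : ℝ) 1, HasDerivAt Φ (φ r) r)
    (hnorm : ∀ w ∈ unitDisk, ∀ r ∈ Set.Ioo (0 : ℝ) 1, ‖w‖ ≤ r → ‖h w - 1‖ ≤ r * φ r)
    (hΦ1 : Φ 1 ≤ β₀) : HoldsWithSharpBound h β₀ := by
  subst hβ₀
  have hΨ1 : 0 < Ψ 1 := hΨ0 ▸ lt_value_at_one hΨc hΨ hψ le_rfl one_pos
  have he := Real.exp_pos 1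
  have hee : Real.exp (-1) * Real.exp 1 = 1 := by rw [← Real.exp_add]; simp
  -- The modulus bound at w = -r gives ψ ≤ φ.
  have hφ : ∀ r ∈ Set.Ioo (0 : ℝ) 1, 0 < φ r := fun r hr => by
    have hn : ‖-(r : ℂ)‖ = r := by rw [norm_neg, norm_real, Real.norm_of_nonneg hr.1.le]
    have h1 := hnorm (-r) (mem_unitDisk.2 (hn.trans_lt hr.2)) r hr hn.le
    have h2 : h (-r) - 1 = -((r * ψ r : ℝ) : ℂ) := by rw [hneg r hr]; push_cast; ring
    rw [h2, norm_neg, norm_real, Real.norm_of_nonneg (mul_pos hr.1 (hψ r hr)).le] at h1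
    exact (hψ r hr).trans_le (le_of_mul_le_mul_left h1 hr.1)
  constructor
  · rintro β hβ p hp ⟨w, hw, hpw⟩
    have hβ0 : 0 < β := (mul_pos he hΨ1).trans_le hβ
    have hwn : ∀ z ∈ unitDisk, ‖w z‖ ≤ ‖z‖ := fun z hz =>
      norm_le_norm_of_mapsTo_ball hw.analytic.differentiableOn
        (hw.mapsTo.mono_right Metric.ball_subset_closedBall) hw.map_zero
        (mem_unitDisk.1 hz)
    have hIoo : ∀ z ∈ unitDisk, z ≠ 0 → ‖z‖ ∈ Set.Ioo (0 : ℝ) 1 := fun z hz hz0 =>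
      ⟨norm_pos_iff.2 hz0, mem_unitDisk.1 hz⟩
    -- The factor c is 1 for the modulus estimate and -1 for the lower bound on the real part.
    have hPd : ∀ c : ℂ, ∀ z ∈ unitDisk,
        z * deriv (fun x => c * (β * (p x - 1))) z = c * (h (w z) - 1) := fun c z hz => by
      have hd := (hp.1 z hz).differentiableAt
      rw [deriv_const_mul _ ((hd.sub_const 1).const_mul _), deriv_const_mul _ (hd.sub_const 1),
        deriv_sub_const, ← hpw z hz, diffExpr]
      ring
    have hPa : ∀ c : ℂ, AnalyticOnNhd ℂ (fun x => c * (β * (p x - 1))) unitDisk := fun c z hz =>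
      analyticAt_const.mul (analyticAt_const.mul ((hp.1 z hz).sub analyticAt_const))
    have hP0 : ∀ c : ℂ, c * (β * (p 0 - 1)) = 0 := fun c => by rw [hp.2]; ring
    refine subordinate_cardioid_of_norm_lt_of_re_gt hp (fun z hz => ?_) fun z hz => ?_
    · have h1 := norm_le_of_norm_radial_deriv_le (hPa 1) (hP0 1) hΦc hΦ0 hΦ
        (fun x hx hx0 => by
          rw [hPd 1 x hx, one_mul]
          exact hnorm _ (hw.mapsTo hx) _ (hIoo x hx hx0) (hwn x hx)) hz
      have h2 := lt_value_at_one hΦc hΦ hφ (norm_nonneg z) (mem_unitDisk.1 hz)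
      rw [one_mul, norm_mul, norm_real, Real.norm_of_nonneg hβ0.le] at h1
      nlinarith
    · have h1 := re_le_of_real_radial_deriv_le (hPa (-1)) (hP0 (-1)) hΨc hΨ0 hΨ
        (fun x hx hx0 him => by
          rw [hPd (-1) x hx] at him ⊢
          have h3 := hreal _ (hw.mapsTo hx) (by simpa using him) _ (hIoo x hx hx0) (hwn x hx)
          simp only [neg_mul, one_mul, neg_re, sub_re, one_re]
          linarith) hz
      have h2 := lt_value_at_one hΨc hΨ hψ (norm_nonneg z) (mem_unitDisk.1 hz)
      rw [neg_one_mul, neg_re, re_ofReal_mul] at h1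
      have h3 : Ψ 1 ≤ Real.exp (-1) * β := by
        have := mul_le_mul_of_nonneg_left hβ (Real.exp_pos (-1)).le
        rwa [← mul_assoc, hee, one_mul] at this
      nlinarith
  · intro β hβ0 hβ himp
    obtain ⟨G, hG, hG0, hGd⟩ := exists_radial_primitive hh h0
    have hβc : (β : ℂ) ≠ 0 := ofReal_ne_zero.2 hβ0.ne'
    -- The extremal p, for which 1 + β z p' equals h itself, with the identity as Schwarz function.
    obtain ⟨w, hw, hpw⟩ := himp (fun z => 1 + G z / β)
      ⟨fun z hz => analyticAt_const.add ((hG z hz).div_const), by simp [hG0]⟩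
      ⟨id, ⟨analyticOnNhd_id, Set.mapsTo_id _, rfl⟩, fun z hz => by
        rw [diffExpr, deriv_const_add, deriv_div_const, id, mul_assoc, mul_div_assoc', hGd z hz]
        field_simp
        ring⟩
    -- β < e Ψ(1) means Ψ(1) > β/e, and continuity at 1 carries this to some r < 1.
    have hev : ∀ᶠ r in 𝓝[<] (1 : ℝ), Real.exp (-1) * β < Ψ r := by
      have hlt : Real.exp (-1) * β < Ψ 1 := by
        have := mul_lt_mul_of_pos_left hβ (Real.exp_pos (-1))
        rwa [← mul_assoc, hee, one_mul] at this
      have ht : Tendsto Ψ (𝓝[<] (1 : ℝ)) (𝓝 (Ψ 1)) :=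
        ((hΨc 1 ⟨zero_le_one, le_rfl⟩).mono_of_mem_nhdsWithin
          (Icc_mem_nhdsLT (zero_lt_one' ℝ))).tendsto
      exact ht.eventually (lt_mem_nhds hlt)
    obtain ⟨r, hr, hr01⟩ := (hev.and (Ioo_mem_nhdsLT (zero_lt_one' ℝ))).exists
    have hmem : -(r : ℂ) ∈ unitDisk := by
      rw [mem_unitDisk, norm_neg, norm_real, Real.norm_of_nonneg hr01.1.le]
      exact hr01.2
    have h1 := hpw _ hmem
    simp only [radial_primitive_neg hG hG0 hGd hΨc hΨ0 hΨ hneg hr01.1 hr01.2, cardioid,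
      add_right_inj] at h1
    have h2 := neg_exp_neg_one_le_of_mul_exp_real (hw.mapsTo hmem) (x := -Ψ r / β)
      (by rw [← h1]; push_cast; rfl)
    rw [neg_div, neg_le_neg_iff, div_le_iff₀ hβ0] at h2
    exact h2.not_gt hr


/-! ### Auxiliary estimates and the two square-root functions -/

/-- Integrating χ ≤ ψ from 0 to 1; this bounds below the values Ψ(1) that are given only as series.
-/
theorem value_at_one_le {Ψ ψ Χ χ : ℝ → ℝ} (hΨc : ContinuousOn Ψ (Set.Icc 0 1))
    (hΨ : ∀ r ∈ Set.Ioo (0 : ℝ) 1, HasDerivAt Ψ (ψ r) r)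
    (hΧc : ContinuousOn Χ (Set.Icc 0 1))
    (hΧ : ∀ r ∈ Set.Ioo (0 : ℝ) 1, HasDerivAt Χ (χ r) r) (h0 : Χ 0 = Ψ 0)
    (hle : ∀ r ∈ Set.Ioo (0 : ℝ) 1, χ r ≤ ψ r) : Χ 1 ≤ Ψ 1 := by
  have h := monotoneOn_of_deriv_nonneg (convex_Icc (0 : ℝ) 1) (hΨc.sub hΧc)
    (fun r hr => by
      rw [interior_Icc] at hr
      exact ((hΨ r hr).sub (hΧ r hr)).differentiableAt.differentiableWithinAt)
    (fun r hr => by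
      rw [interior_Icc] at hr
      rw [((hΨ r hr).sub (hΧ r hr)).deriv]
      exact sub_nonneg.2 (hle r hr))
  have h1 := h (Set.left_mem_Icc.2 zero_le_one) (Set.right_mem_Icc.2 zero_le_one) zero_le_one
  simp only [Pi.sub_apply] at h1
  linarith

theorem abs_re_lt_one {w : ℂ} (hw : w ∈ unitDisk) : |w.re| < 1 :=
  (abs_re_le_norm w).trans_lt (mem_unitDisk.1 hw)

theorem neg_le_of_norm_ofReal_le {x r : ℝ} (h : ‖(x : ℂ)‖ ≤ r) : -r ≤ x := by
  rw [norm_real, Real.norm_eq_abs] at h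
  exact (abs_le.1 h).1

theorem csqrt_sq (z : ℂ) : sqrt z ^ 2 = z := by
  rw [sqrt]
  exact_mod_cast cpow_nat_inv_pow z two_ne_zero

theorem csqrt_re_nonneg (z : ℂ) : 0 ≤ (sqrt z).re := by
  rw [sqrt, cpow_inv_two_re]
  exact Real.sqrt_nonneg _

theorem csqrt_ofReal {x : ℝ} (hx : 0 ≤ x) : sqrt (x : ℂ) = (Real.sqrt x : ℂ) := by
  rw [sqrt_of_nonneg (by exact_mod_cast hx), ofReal_re]

theorem norm_csqrt_one_add_sub_one_le (w : ℂ) : ‖sqrt (1 + w) - 1‖ ≤ ‖w‖ := by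
  have h1 : (sqrt (1 + w) - 1) * (sqrt (1 + w) + 1) = w := by
    linear_combination csqrt_sq (1 + w)
  have h2 : 1 ≤ ‖sqrt (1 + w) + 1‖ := by
    refine le_trans ?_ (re_le_norm _)
    have := csqrt_re_nonneg (1 + w)
    rw [add_re, one_re]
    linarith
  calc ‖sqrt (1 + w) - 1‖ ≤ ‖sqrt (1 + w) - 1‖ * ‖sqrt (1 + w) + 1‖ :=
        le_mul_of_one_le_right (norm_nonneg _) h2
    _ = ‖w‖ := by rw [← norm_mul, h1]

theorem one_add_mem_slitPlane {w : ℂ} (hw : ‖w‖ < 1) : 1 + w ∈ slitPlane := by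
  left
  have := (abs_le.1 (abs_re_le_norm w)).1
  rw [add_re, one_re]
  linarith

theorem norm_sq_lt_one {w : ℂ} (hw : w ∈ unitDisk) : ‖w ^ 2‖ < 1 := by
  rw [norm_pow]
  exact pow_lt_one₀ (norm_nonneg _) (mem_unitDisk.1 hw) two_ne_zero

theorem exp_one_bounds : 2.718 < Real.exp 1 ∧ Real.exp 1 < 2.719 :=
  ⟨lt_trans (by norm_num) Real.exp_one_gt_d9, Real.exp_one_lt_d9.trans (by norm_num)⟩

theorem sqrt_two_bounds : 1.4142 < Real.sqrt 2 ∧ Real.sqrt 2 < 1.4143 :=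
  ⟨by rw [Real.lt_sqrt (by norm_num)]; norm_num, by rw [Real.sqrt_lt' (by norm_num)]; norm_num⟩

/-- Rationalising (1 - √(1 - r))/r gives ψ = 1/(1 + √(1 - r)). The majorant Φ(r) = r suffices
because 1 < 2e(1 - log 2). -/
theorem sharp_sqrt : HoldsWithSharpBound (fun z => sqrt (1 + z))
    (2 * Real.exp 1 * (1 - Real.log 2)) := by
  have key : 2 * Real.exp 1 * (1 - Real.log 2) = Real.exp 1 *
      (2 * (1 - Real.sqrt (1 - 1)) - 2 * Real.log 2 + 2 * Real.log (1 + Real.sqrt (1 - 1))) := by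
    simp only [sub_self, Real.sqrt_zero, add_zero, Real.log_one]
    ring
  have hpos : ∀ x : ℝ, 1 + Real.sqrt x ≠ 0 := fun x => by positivity
  have hle := Real.log_two_lt_d9
  refine holdsWithSharpBound_of_radial_bounds ?_ (by simp)
    (fun r => 2 * (1 - Real.sqrt (1 - r)) - 2 * Real.log 2 + 2 * Real.log (1 + Real.sqrt (1 - r)))
    (fun r => 1 / (1 + Real.sqrt (1 - r))) (fun r => r) (fun _ => 1) key
    ?_ ?_ ?_ ?_ ?_ ?_ continuousOn_id rfl
    (fun r _ => hasDerivAt_id r) ?_ ?_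
  · exact DifferentiableOn.analyticOnNhd (fun z hz =>
      (DifferentiableAt.comp z (differentiableAt_sqrt (one_add_mem_slitPlane (mem_unitDisk.1 hz)))
        (by fun_prop)).differentiableWithinAt) isOpen_unitDisk
  · have h1 : Continuous fun r : ℝ => 1 + Real.sqrt (1 - r) := by fun_prop
    have h2 := (h1.log fun _ => hpos _).const_mul 2
    exact Continuous.continuousOn (by fun_prop)
  · norm_num
  · intro r hr
    have h1 : 0 < 1 - r := by linarith [hr.2]
    have hs := Real.sqrt_pos.2 h1
    have h2 := ((hasDerivAt_id r).const_sub 1).sqrt h1.ne'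
    have h3 := (((h2.const_sub 1).const_mul 2).sub_const (2 * Real.log 2)).add
      (((h2.const_add 1).log (hpos _)).const_mul 2)
    refine h3.congr_deriv ?_
    simp only [id]
    field_simp
    ring
  · intro r _
    positivity
  · intro r hr
    have h1 : 0 ≤ 1 - r := by linarith [hr.2]
    have h2 : (1 : ℂ) + -r = ((1 - r : ℝ) : ℂ) := by push_cast; ring
    have h3 : r * (1 / (1 + Real.sqrt (1 - r))) = 1 - Real.sqrt (1 - r) := by
      have := Real.sq_sqrt h1
      have := hpos (1 - r)
      field_simp
      linarith
    rw [h2, csqrt_ofReal h1, ← ofReal_mul, h3]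
    push_cast
    ring
  · intro w hw him r hr hwr
    have h1 : 0 ≤ 1 - r := by linarith [hr.2]
    have h3 : r * (1 / (1 + Real.sqrt (1 - r))) = 1 - Real.sqrt (1 - r) := by
      have := Real.sq_sqrt h1
      have := hpos (1 - r)
      field_simp
      linarith
    -- The root is real, so its square has real part 1 + Re w ≥ 1 - r.
    have h4 : ((sqrt (1 + w)).re) ^ 2 = 1 + w.re := by
      have := congrArg re (csqrt_sq (1 + w))
      rw [sq, mul_re, him] at this
      simp only [add_re, one_re] at this
      linarith
    have h5 := (abs_le.1 (abs_re_le_norm w)).1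
    rw [h3, sub_sub_cancel]
    exact Real.sqrt_le_iff.2 ⟨csqrt_re_nonneg _, by linarith⟩
  · intro w _ r _ hwr
    rw [mul_one]
    exact (norm_csqrt_one_add_sub_one_le w).trans hwr
  · nlinarith [exp_one_bounds.1]

theorem sharp_crescent : HoldsWithSharpBound (fun z => z + sqrt (1 + z ^ 2))
    (Real.exp 1 * (3 - k + Real.log (k / 2))) := by
  have key : 3 - k + Real.log (k / 2) =
      1 - Real.sqrt (1 + 1 ^ 2) + 1 + Real.log ((1 + Real.sqrt (1 + 1 ^ 2)) / 2) := by
    norm_num [k]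
    ring
  have hpos : ∀ x : ℝ, 1 + Real.sqrt x ≠ 0 := fun x => by positivity
  have hsub : ∀ r : ℝ, 1 - r * (1 - r / (1 + Real.sqrt (1 + r ^ 2)))
      = -r + Real.sqrt (1 + r ^ 2) := by
    intro r
    have := Real.sq_sqrt (show 0 ≤ 1 + r ^ 2 by positivity)
    have := hpos (1 + r ^ 2)
    field_simp
    linarith
  refine holdsWithSharpBound_of_radial_bounds ?_ (by simp)
    (fun r => r - Real.sqrt (1 + r ^ 2) + 1 + Real.log ((1 + Real.sqrt (1 + r ^ 2)) / 2))
    (fun r => 1 - r / (1 + Real.sqrt (1 + r ^ 2))) (fun r => 2 * r) (fun _ => 2)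
    (congrArg _ key) ?_ (by norm_num) ?_ ?_ ?_ ?_
    (by fun_prop) (by simp) (fun r _ => by simpa using (hasDerivAt_id r).const_mul 2) ?_ ?_
  · exact DifferentiableOn.analyticOnNhd (fun z hz =>
      (differentiableAt_id.add (DifferentiableAt.comp z (f := fun z : ℂ => 1 + z ^ 2)
        (differentiableAt_sqrt (one_add_mem_slitPlane (norm_sq_lt_one hz)))
        (by fun_prop))).differentiableWithinAt) isOpen_unitDisk
  · exact Continuous.continuousOn (by fun_prop (disch := intros; positivity))
  · intro r hr
    have h1 : 0 < 1 + r ^ 2 := by positivity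
    have hs := Real.sqrt_pos.2 h1
    have h2 := (((hasDerivAt_id r).pow 2).const_add 1).sqrt h1.ne'
    have h3 := (((hasDerivAt_id r).sub h2).add_const 1).add
      (((h2.const_add 1).div_const 2).log (div_ne_zero (hpos _) two_ne_zero))
    refine h3.congr_deriv ?_
    simp only [id, Pi.pow_apply]
    field_simp
    ring
  · intro r hr
    have h1 := Real.sqrt_nonneg (1 + r ^ 2)
    rw [sub_pos, div_lt_one (by positivity)]
    linarith [hr.2]
  · intro r hr
    have h2 : (1 : ℂ) + (-r) ^ 2 = ((1 + r ^ 2 : ℝ) : ℂ) := by push_cast; ring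
    have h3 := congrArg (fun x : ℝ => (x : ℂ)) (hsub r)
    simp only [ofReal_add, ofReal_sub, ofReal_mul, ofReal_one, ofReal_neg] at h3
    rw [h2, csqrt_ofReal (by positivity), ← h3]
    push_cast
    ring
  · intro w hw him r hr hwr
    obtain ⟨σ, hσ⟩ : ∃ σ : ℝ, w + sqrt (1 + w ^ 2) = σ := ⟨_, Complex.ext rfl (by simpa using him)⟩
    have hs := csqrt_sq (1 + w ^ 2)
    have hs' : sqrt (1 + w ^ 2) = σ - w := by linear_combination hσ
    rw [hs'] at hs
    -- Squaring σ - w = √(1 + w²) leaves an equation linear in w, so a real value σ forces w real;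
    -- there x + √(1 + x²) is increasing.
    have h1 : (σ : ℂ) ^ 2 - 2 * σ * w = 1 := by linear_combination hs
    have hσ0 : σ ≠ 0 := by
      rintro rfl
      simp at h1
    have hw' : w = (((σ ^ 2 - 1) / (2 * σ) : ℝ) : ℂ) := by
      have : (σ : ℂ) ≠ 0 := ofReal_ne_zero.2 hσ0
      push_cast
      field_simp
      linear_combination -h1
    generalize (σ ^ 2 - 1) / (2 * σ) = x at hw'
    subst hw'
    have hx := neg_le_of_norm_ofReal_le hwr
    have h2 : (1 : ℂ) + (x : ℂ) ^ 2 = ((1 + x ^ 2 : ℝ) : ℂ) := by push_cast; ring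
    rw [hsub, h2, csqrt_ofReal (by positivity), ← ofReal_add, ofReal_re]
    have h3 := Real.sq_sqrt (show 0 ≤ 1 + x ^ 2 by positivity)
    have h4 := Real.sqrt_nonneg (1 + x ^ 2)
    have h5 : 0 ≤ x + Real.sqrt (1 + x ^ 2) := by
      have := Real.abs_le_sqrt (show x ^ 2 ≤ 1 + x ^ 2 by linarith)
      linarith [neg_abs_le x]
    have h6 : Real.sqrt (1 + r ^ 2) ≤ Real.sqrt (1 + x ^ 2) + (r + x) := by
      refine Real.sqrt_le_iff.2 ⟨by linarith, ?_⟩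
      nlinarith [mul_nonneg (show 0 ≤ r + x by linarith) h5]
    linarith
  · intro w hw r hr hwr
    have h1 := norm_csqrt_one_add_sub_one_le (w ^ 2)
    have h2 : ‖w ^ 2‖ ≤ ‖w‖ := by
      rw [norm_pow]
      exact pow_le_of_le_one (norm_nonneg _) (mem_unitDisk.1 hw).le two_ne_zero
    rw [add_sub_assoc]
    refine (norm_add_le _ _).trans ?_
    linarith
  · obtain ⟨h2, h1⟩ := sqrt_two_bounds
    have hk : 0 < k / 2 := by rw [k]; positivity
    have h3 := Real.one_sub_inv_le_log_of_pos hk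
    have h4 : (k / 2)⁻¹ < 0.829 := by
      rw [inv_lt_comm₀ hk (by norm_num), k]
      norm_num
      linarith
    -- From log(k/2) ≥ 1 - 2/k; this is enough for Φ(1) = 2 ≤ β₀, as 0.7557 e > 2.
    have h5 : (0.7557 : ℝ) ≤ 3 - k + Real.log (k / 2) := by
      rw [k] at *
      linarith
    have h6 := exp_one_bounds.1
    nlinarith

/-! ### Functions with |h - 1| largest on the negative radius -/

/-- When |h - 1| on |w| ≤ r is greatest at -r, the modulus bound already implies the real one, and Φ
= Ψ works since e > 1. -/
theorem sharp_of_norm_bounds {h : ℂ → ℂ} (hh : AnalyticOnNhd ℂ h unitDisk)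
    (h0 : h 0 = 1) (Ψ ψ : ℝ → ℝ) {β₀ : ℝ} (hβ₀ : β₀ = Real.exp 1 * Ψ 1)
    (hΨc : ContinuousOn Ψ (Set.Icc 0 1)) (hΨ0 : Ψ 0 = 0)
    (hΨ : ∀ r ∈ Set.Ioo (0 : ℝ) 1, HasDerivAt Ψ (ψ r) r)
    (hψ : ∀ r ∈ Set.Ioo (0 : ℝ) 1, 0 < ψ r)
    (hneg : ∀ r : ℝ, r ∈ Set.Ioo (0 : ℝ) 1 → h (-r) = 1 - r * ψ r)
    (hnorm : ∀ w ∈ unitDisk, ∀ r ∈ Set.Ioo (0 : ℝ) 1, ‖w‖ ≤ r → ‖h w - 1‖ ≤ r * ψ r) :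
    HoldsWithSharpBound h β₀ := by
  refine holdsWithSharpBound_of_radial_bounds hh h0 Ψ ψ Ψ ψ hβ₀ hΨc hΨ0 hΨ hψ hneg ?_
    hΨc hΨ0 hΨ hnorm ?_
  · intro w hw _ r hr hwr
    have h1 := (abs_le.1 (abs_re_le_norm (h w - 1))).1
    have h2 := hnorm w hw r hr hwr
    rw [sub_re, one_re] at h1
    linarith
  · have h1 : 0 < Ψ 1 := hΨ0 ▸ lt_value_at_one hΨc hΨ hψ le_rfl one_pos
    rw [hβ₀]
    nlinarith [exp_one_bounds.1]

theorem norm_one_sub_mul_ge {a t : ℝ} {z : ℂ} (ha : 0 ≤ a) (hz : ‖z‖ ≤ t) :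
    1 - a * t ≤ ‖1 - a * z‖ := by
  have h1 := norm_sub_norm_le (1 : ℂ) (a * z)
  rw [norm_one, norm_mul, norm_real, Real.norm_of_nonneg ha] at h1
  nlinarith

theorem norm_div_le_mul_inv {x y : ℂ} {r d : ℝ} (hx : ‖x‖ ≤ r) (hd : 0 < d) (hy : d ≤ ‖y‖) :
    ‖x / y‖ ≤ r * (1 / d) := by
  rw [norm_div, div_eq_mul_one_div]
  exact mul_le_mul hx (one_div_le_one_div_of_le hd hy) (by positivity)
    ((norm_nonneg _).trans hx)

theorem sharp_booth {α : ℝ} (hα : 0 < α) (hα1 : α < 1) :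
    HoldsWithSharpBound (fun z => 1 + z / (1 - (α : ℂ) * z ^ 2))
      (Real.exp 1 * Real.log ((1 + Real.sqrt α) / (1 - Real.sqrt α)) / (2 * Real.sqrt α)) := by
  have hs := Real.sqrt_pos.2 hα
  have hs1 : Real.sqrt α < 1 := by rwa [Real.sqrt_lt' one_pos, one_pow]
  have hsq := Real.sq_sqrt hα.le
  have key : Real.exp 1 * Real.log ((1 + Real.sqrt α) / (1 - Real.sqrt α)) / (2 * Real.sqrt α)
      = Real.exp 1 * ((Real.log (1 + Real.sqrt α * 1) - Real.log (1 - Real.sqrt α * 1))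
        / (2 * Real.sqrt α)) := by
    simp only [mul_one]
    rw [Real.log_div (by positivity) (by linarith), mul_div_assoc]
  have hden : ∀ r ∈ Set.Icc (0 : ℝ) 1, 0 < 1 - Real.sqrt α * r := fun r hr => by
    nlinarith [hr.1, hr.2]
  have hden' : ∀ r ∈ Set.Icc (0 : ℝ) 1, 0 < 1 + Real.sqrt α * r := fun r hr => by
    nlinarith [hr.1, hr.2]
  have hden2 : ∀ r ∈ Set.Ioo (0 : ℝ) 1, 0 < 1 - α * r ^ 2 := fun r hr => by
    nlinarith [hr.1, hr.2]
  refine sharp_of_norm_bounds ?_ (by simp)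
    (fun r => (Real.log (1 + Real.sqrt α * r) - Real.log (1 - Real.sqrt α * r)) / (2 * Real.sqrt α))
    (fun r => 1 / (1 - α * r ^ 2)) key ?_ (by simp) ?_ ?_ ?_ ?_
  · refine DifferentiableOn.analyticOnNhd (fun z hz => ?_) isOpen_unitDisk
    have h1 : (1 : ℂ) - α * z ^ 2 ≠ 0 := norm_pos_iff.1 <| lt_of_lt_of_le
      (by linarith) (norm_one_sub_mul_ge hα.le (norm_sq_lt_one hz).le)
    exact DifferentiableAt.differentiableWithinAt (by fun_prop (disch := exact h1))
  · refine ContinuousOn.div_const (ContinuousOn.sub ?_ ?_) _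
    · exact ContinuousOn.log (by fun_prop) fun r hr => (hden' r hr).ne'
    · exact ContinuousOn.log (by fun_prop) fun r hr => (hden r hr).ne'
  · intro r hr
    have h1 := hden r ⟨hr.1.le, hr.2.le⟩
    have h2 := hden' r ⟨hr.1.le, hr.2.le⟩
    have h3 := (hasDerivAt_id r).const_mul (Real.sqrt α)
    have h4 := (((h3.const_add 1).log h2.ne').sub ((h3.const_sub 1).log h1.ne')).div_const
      (2 * Real.sqrt α)
    refine h4.congr_deriv ?_
    have h5 : 1 - α * r ^ 2 = (1 + Real.sqrt α * r) * (1 - Real.sqrt α * r) := by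
      linear_combination r ^ 2 * hsq
    rw [h5]
    simp only [id]
    field_simp
    ring
  · intro r hr
    exact one_div_pos.2 (hden2 r hr)
  · intro r hr
    have h1 : (1 : ℂ) - α * r ^ 2 ≠ 0 := by exact_mod_cast (hden2 r hr).ne'
    push_cast
    rw [neg_sq]
    field_simp
    ring
  · intro w hw r hr hwr
    rw [add_sub_cancel_left]
    refine norm_div_le_mul_inv hwr (hden2 r hr) (norm_one_sub_mul_ge hα.le ?_)
    rw [norm_pow]
    gcongr

theorem sharp_janowski {A B : ℝ} (hB : 0 < B) (hAB : B < A) (hA : A < 1) :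
    HoldsWithSharpBound (fun z => (1 + (A : ℂ) * z) / (1 + (B : ℂ) * z))
      (max (Real.exp 1 * (A - B) / B * Real.log (1 / (1 - B)))
        ((A - B) / (Real.exp 1 * B) * Real.log (1 + B))) := by
  have hc : 0 < (A - B) / B := div_pos (by linarith) hB
  have he := exp_one_bounds.1
  -- The first entry is always the larger: log(1 + B) ≤ B ≤ -log(1 - B) and e > 1.
  have key : max (Real.exp 1 * (A - B) / B * Real.log (1 / (1 - B)))
        ((A - B) / (Real.exp 1 * B) * Real.log (1 + B))
      = Real.exp 1 * -((A - B) / B * Real.log (1 - B * 1)) := by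
    have h1 : Real.log (1 + B) ≤ B := by
      linarith [Real.log_le_sub_one_of_pos (show 0 < 1 + B by linarith)]
    have h2 : Real.log (1 - B) ≤ -B := by
      linarith [Real.log_le_sub_one_of_pos (show 0 < 1 - B by linarith)]
    have h3 : Real.exp 1 * (A - B) / B * Real.log (1 / (1 - B))
        = (A - B) / B * (Real.exp 1 * -Real.log (1 - B)) := by
      rw [one_div, Real.log_inv]; ring
    have h4 : (A - B) / (Real.exp 1 * B) * Real.log (1 + B)
        = (A - B) / B * (Real.log (1 + B) / Real.exp 1) := by
      have := Real.exp_pos 1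
      field_simp
    rw [h3, h4, max_eq_left]
    · simp only [mul_one]; ring
    · refine mul_le_mul_of_nonneg_left ?_ hc.le
      calc Real.log (1 + B) / Real.exp 1 ≤ B / 1 :=
            div_le_div₀ hB.le h1 one_pos (by linarith)
        _ ≤ Real.exp 1 * -Real.log (1 - B) := by nlinarith
  have hden : ∀ r ∈ Set.Icc (0 : ℝ) 1, 0 < 1 - B * r := fun r hr => by
    nlinarith [hr.1, hr.2]
  have hsub : ∀ z : ℂ, ∀ t : ℝ, ‖z‖ ≤ t → 1 - B * t ≤ ‖1 + B * z‖ :=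
    fun z t hz => by
      simpa using norm_one_sub_mul_ge (z := -z) hB.le (by simpa using hz)
  have hne : ∀ z ∈ unitDisk, (1 : ℂ) + B * z ≠ 0 := fun z hz =>
    norm_pos_iff.1 <| lt_of_lt_of_le (by linarith)
      (hsub z 1 (mem_unitDisk.1 hz).le)
  refine sharp_of_norm_bounds ?_ (by simp) (fun r => -((A - B) / B * Real.log (1 - B * r)))
    (fun r => (A - B) * (1 / (1 - B * r))) key ?_ (by simp) ?_ ?_ ?_ ?_
  · refine DifferentiableOn.analyticOnNhd (fun z hz => ?_) isOpen_unitDisk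
    have h1 := hne z hz
    exact DifferentiableAt.differentiableWithinAt (by fun_prop (disch := exact h1))
  · exact (continuousOn_const.mul
      (ContinuousOn.log (by fun_prop) fun r hr => (hden r hr).ne')).neg
  · intro r hr
    have h1 := hden r ⟨hr.1.le, hr.2.le⟩
    have h3 := (hasDerivAt_id r).const_mul B
    refine ((((h3.const_sub 1).log h1.ne').const_mul ((A - B) / B)).neg).congr_deriv ?_
    simp only [id]
    field_simp
  · intro r hr
    exact mul_pos (by linarith) (one_div_pos.2 (hden r ⟨hr.1.le, hr.2.le⟩))
  · intro r hr
    have h1 : (1 : ℂ) - B * r ≠ 0 := by exact_mod_cast (hden r ⟨hr.1.le, hr.2.le⟩).ne'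
    have h2 : (1 : ℂ) + B * -r = 1 - B * r := by ring
    rw [h2, div_eq_iff h1]
    push_cast
    linear_combination (r * (A - B) : ℂ) * mul_inv_cancel₀ h1
  · intro w hw r hr hwr
    have h1 := hne w hw
    have h2 : (1 + (A : ℂ) * w) / (1 + B * w) - 1 = (A - B : ℝ) * (w / (1 + B * w)) := by
      rw [div_sub_one h1]
      push_cast
      ring
    rw [h2, norm_mul, norm_real, Real.norm_of_nonneg (by linarith), mul_left_comm]
    refine mul_le_mul_of_nonneg_left ?_ (by linarith)
    exact norm_div_le_mul_inv hwr (hden r ⟨hr.1.le, hr.2.le⟩) (hsub w r hwr)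


/-! ### The rational function `phi0` -/

theorem k_bounds : 2.4142 < k ∧ k < 2.4143 := by
  have := sqrt_two_bounds
  constructor <;> rw [k] <;> linarith

theorem k_sq : k ^ 2 = 2 * k + 1 := by
  have := Real.sq_sqrt (show (0 : ℝ) ≤ 2 by norm_num)
  rw [k]
  linear_combination this

theorem sub_norm_le_norm_ofReal_sub {a : ℝ} {w : ℂ} {r : ℝ} (hw : ‖w‖ ≤ r) :
    a - r ≤ ‖(a : ℂ) - w‖ := by
  have h1 := re_le_norm ((a : ℂ) - w)
  have h2 := re_le_norm w
  rw [sub_re, ofReal_re] at h1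
  linarith

theorem phi0_denom_ne_zero {w : ℂ} (hw : w ∈ unitDisk) : (k : ℂ) - w ≠ 0 := by
  have h1 := sub_norm_le_norm_ofReal_sub (a := k) (mem_unitDisk.1 hw).le
  exact norm_pos_iff.1 (by linarith [k_bounds.1])

/-- Real values of `phi0` in the unit disk are taken at real points. -/
theorem conj_eq_of_phi0_real {w : ℂ} (hw : w ∈ unitDisk) {c : ℝ} (h : phi0 w = c) :
    (starRingEnd ℂ) w = w := by
  have hk := k_bounds
  have hk0 : (k : ℂ) ≠ 0 := ofReal_ne_zero.2 (by linarith)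
  have h1 := phi0_denom_ne_zero hw
  set v := (starRingEnd ℂ) w with hv
  have hvn : ‖v‖ < 1 := by rw [hv, norm_conj]; exact mem_unitDisk.1 hw
  have h2 : w * (k + w) = (c - 1) * k * (k - w) := by
    rw [phi0] at h
    field_simp at h
    linear_combination h
  have h3 : v * (k + v) = (c - 1) * k * (k - v) := by
    simpa using congrArg (starRingEnd ℂ) h2
  -- Clearing denominators in the equality of the values at w and its conjugate v. The second factor
  -- cannot vanish: |k - w| |k - v| < (k + 1)² = 2k², by k² = 2k + 1.
  have h4 : (w - v) * ((k - w) * (k - v) - 2 * k ^ 2) = 0 := by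
    linear_combination (k - v) * h2 * (-1) + (k - w) * h3
  rcases mul_eq_zero.1 h4 with h5 | h5
  · exact (sub_eq_zero.1 h5).symm
  exfalso
  have h6 : ‖(k : ℂ) - w‖ * ‖(k : ℂ) - v‖ = 2 * k ^ 2 := by
    rw [← norm_mul, sub_eq_zero.1 h5, norm_mul, norm_pow, norm_real,
      Real.norm_of_nonneg (by linarith)]
    norm_num
  have hle : ∀ x : ℂ, ‖x‖ < 1 → ‖(k : ℂ) - x‖ < k + 1 := fun x hx => by
    refine (norm_sub_le _ _).trans_lt ?_
    rw [norm_real, Real.norm_of_nonneg (by linarith)]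
    linarith
  have h7 := mul_lt_mul'' (hle w (mem_unitDisk.1 hw)) (hle v hvn) (norm_nonneg _) (norm_nonneg _)
  rw [h6] at h7
  nlinarith [k_sq]

theorem phi0_ofReal (x : ℝ) : phi0 x = ((1 + x / k * ((k + x) / (k - x)) : ℝ) : ℂ) := by
  rw [phi0]
  push_cast
  rfl

theorem sharp_phi0 : HoldsWithSharpBound phi0
    (Real.exp 1 * (-1 + 2 * k * Real.log (1 + 1 / k)) / k) := by
  have hk := k_bounds
  have hk0 : 0 < k := by linarith
  have hk2 := k_sq
  have h2k : 1 + 1 / k = Real.sqrt 2 := by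
    have : Real.sqrt 2 = k - 1 := by rw [k]; ring
    rw [this]
    field_simp
    linarith
  have hψ : ∀ r ∈ Set.Ioo (0 : ℝ) 1,
      1 - r * ((k - r) / (k * (k + r))) = 1 + (-r) / k * ((k + -r) / (k - -r)) := fun r hr => by
    have := hr.1
    rw [sub_neg_eq_add, ← sub_eq_add_neg]
    field_simp
    ring
  refine holdsWithSharpBound_of_radial_bounds ?_ (by simp [phi0])
    (fun r => (-r + 2 * k * Real.log (1 + r / k)) / k) (fun r => (k - r) / (k * (k + r)))
    -- φ comes from the chord of the convex function (k + r)/(k - r) on [0, 1], whose end values are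
    -- 1 and k.
    (fun r => (r + r ^ 2 * (k - 1) / 2) / k) (fun r => (1 + r * (k - 1)) / k) (mul_div_assoc _ _ _)
    ?_ (by simp) ?_ ?_ ?_ ?_ (by fun_prop) (by simp) ?_ ?_ ?_
  · refine DifferentiableOn.analyticOnNhd (fun z hz => ?_) isOpen_unitDisk
    have h1 := phi0_denom_ne_zero hz
    unfold phi0
    exact DifferentiableAt.differentiableWithinAt (by fun_prop (disch := exact h1))
  · have h1 : ContinuousOn (fun r : ℝ => Real.log (1 + r / k)) (Set.Icc 0 1) :=
      ContinuousOn.log (by fun_prop) fun r hr => by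
        have := div_nonneg hr.1 hk0.le
        positivity
    fun_prop
  · intro r hr
    have hr0 := hr.1
    have h1 : 1 + r / k ≠ 0 := by positivity
    have h2 := (((hasDerivAt_id r).div_const k).const_add 1).log h1
    refine (((hasDerivAt_id r).neg.add (h2.const_mul (2 * k))).div_const k).congr_deriv ?_
    simp only [id]
    field_simp
    ring
  · intro r hr
    have := hr.1
    exact div_pos (by linarith [hr.2]) (by positivity)
  · intro r hr
    have h1 := phi0_ofReal (-r)
    rw [← hψ r hr] at h1
    rw [← ofReal_neg, h1]
    push_cast
    rfl
  · intro w hw him r hr hwr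
    have h1 := conj_eq_of_phi0_real hw (c := (phi0 w).re) (Complex.ext rfl (by simpa using him))
    obtain ⟨x, rfl⟩ := conj_eq_iff_real.1 h1
    have hx := neg_le_of_norm_ofReal_le hwr
    have hx1 := (abs_lt.1 (abs_re_lt_one hw)).2
    rw [ofReal_re] at hx1
    have hr0 := hr.1
    have hr1 := hr.2
    rw [phi0_ofReal, ofReal_re, hψ r hr, add_le_add_iff_left, div_mul_div_comm, div_mul_div_comm,
      div_le_div_iff₀ (mul_pos hk0 (by linarith)) (mul_pos hk0 (by linarith))]
    -- The cross-multiplied difference is k (x + r) times this. At x = -r it equals k² - 2kr - r²,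
    -- which decreases to k² - 2k - 1 = 0 at r = 1.
    have h2 : 0 ≤ (k + r) * x + k * (k - r) := by nlinarith
    nlinarith [mul_nonneg hk0.le (mul_nonneg (show 0 ≤ x + r by linarith) h2)]
  · intro r _
    have h1 := ((hasDerivAt_id r).pow 2).mul_const (k - 1)
    refine (((hasDerivAt_id r).add (h1.div_const 2)).div_const k).congr_deriv ?_
    simp only [id]
    ring
  · intro w hw r hr hwr
    have hr0 := hr.1
    have hr1 := hr.2
    have h1 : ‖(k : ℂ) + w‖ ≤ k + r := by
      refine (norm_add_le _ _).trans ?_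
      rw [norm_real, Real.norm_of_nonneg hk0.le]
      linarith
    have h2 : k - r ≤ ‖(k : ℂ) - w‖ := sub_norm_le_norm_ofReal_sub hwr
    have h3 : (k + r) / (k - r) ≤ 1 + r * (k - 1) := by
      rw [div_le_iff₀ (by linarith)]
      have h4 : 0 ≤ r * (1 - r) * (k - 1) :=
        mul_nonneg (mul_nonneg hr0.le (by linarith)) (by linarith)
      nlinarith
    have h4 : ‖(k : ℂ) + w‖ / ‖(k : ℂ) - w‖ ≤ (k + r) / (k - r) :=
      div_le_div₀ (by linarith) h1 (by linarith) h2
    rw [phi0, add_sub_cancel_left, norm_mul, norm_div, norm_div, norm_real,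
      Real.norm_of_nonneg hk0.le, div_mul_eq_mul_div, ← mul_div_assoc r]
    gcongr
    exact h4.trans h3
  · have h1 : Real.log (1 + 1 / k) = Real.log 2 / 2 := by
      rw [h2k, Real.log_sqrt (by norm_num)]
    rw [h1]
    refine div_le_div_of_nonneg_right ?_ hk0.le
    have h2 := Real.log_two_gt_d9
    have h3 := exp_one_bounds.1
    have h4 : 0.67 ≤ -1 + 2 * k * (Real.log 2 / 2) := by nlinarith
    nlinarith

/-! ### Sine and exponential: Ψ as a power series -/

theorem summable_two_pow_succ_div_factorial :
    Summable fun n : ℕ => (2 : ℝ) ^ (n + 1) / (Nat.factorial (n + 1) : ℝ) :=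
  (summable_nat_add_iff 1).2 (Real.summable_pow_div_factorial 2)

theorem summable_two_pow_odd_div_factorial :
    Summable fun n : ℕ => (2 : ℝ) ^ (2 * n + 1) / (Nat.factorial (2 * n + 1) : ℝ) :=
  (Real.summable_pow_div_factorial 2).comp_injective (i := fun n : ℕ => 2 * n + 1)
    fun a b (h : 2 * a + 1 = 2 * b + 1) => by omega

/-- Termwise differentiation of `∑ aₙ x^(mₙ+1) / ((mₙ+1)! (mₙ+1))` for signs `aₙ`. -/
theorem hasDerivAt_tsum_pow_div_factorial {a : ℕ → ℝ} (ha : ∀ n, |a n| ≤ 1) {m : ℕ → ℕ}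
    (hm : Summable fun n : ℕ => (2 : ℝ) ^ (m n + 1) / (Nat.factorial (m n + 1) : ℝ)) {r : ℝ}
    (hr : r ∈ Set.Ioo (-2 : ℝ) 2) :
    HasDerivAt (fun x : ℝ => ∑' n, a n * x ^ (m n + 1)
        / ((Nat.factorial (m n + 1) : ℝ) * ((m n : ℝ) + 1)))
      (∑' n, a n * r ^ (m n) / (Nat.factorial (m n + 1) : ℝ)) r := by
  -- Working on (-2, 2) keeps [0, 1] in the interior, so continuity of Ψ at the endpoint 1 comes for
  -- free.
  refine hasDerivAt_tsum_of_isPreconnected (y₀ := (0 : ℝ))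
    (g := fun n x => a n * x ^ (m n + 1) / ((Nat.factorial (m n + 1) : ℝ) * ((m n : ℝ) + 1)))
    (g' := fun n x => a n * x ^ m n / (Nat.factorial (m n + 1) : ℝ)) hm isOpen_Ioo
    isPreconnected_Ioo (fun n y _ => ?_) (fun n y hy => ?_) (by norm_num) ?_ hr
  · refine (((hasDerivAt_pow (m n + 1) y).const_mul (a n)).div_const _).congr_deriv ?_
    have : (m n : ℝ) + 1 ≠ 0 := by positivity
    push_cast
    field_simp
  · have hy2 : |y| ≤ 2 := abs_le.2 ⟨hy.1.le, hy.2.le⟩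
    rw [norm_div, norm_mul, norm_pow, Real.norm_eq_abs, Real.norm_eq_abs, Real.norm_natCast]
    refine div_le_div_of_nonneg_right ?_ (by positivity)
    calc |a n| * |y| ^ m n ≤ 1 * 2 ^ m n := by
          gcongr
          exact ha n
      _ ≤ 2 ^ (m n + 1) := by rw [pow_succ]; linarith [pow_pos (two_pos (α := ℝ)) (m n)]
  · simp

theorem continuousOn_of_hasDerivAt_Ioo {Ψ ψ : ℝ → ℝ}
    (h : ∀ r ∈ Set.Ioo (-2 : ℝ) 2, HasDerivAt Ψ (ψ r) r) : ContinuousOn Ψ (Set.Icc 0 1) :=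
  fun r hr => (h r ⟨by linarith [hr.1], by linarith [hr.2]⟩).continuousAt.continuousWithinAt

theorem norm_csin_le {w : ℂ} (hw : ‖w‖ ≤ 1) : ‖sin w‖ ≤ 2 * ‖w‖ := by
  have h1 := norm_exp_sub_one_le (x := -w * I) (by simpa using hw)
  have h2 := norm_exp_sub_one_le (x := w * I) (by simpa using hw)
  have h3 : sin w = ((exp (-w * I) - 1) - (exp (w * I) - 1)) * I / 2 := by rw [sin]; ring
  have h4 := norm_sub_le (exp (-w * I) - 1) (exp (w * I) - 1)
  rw [h3, norm_div, norm_mul, norm_I, mul_one, RCLike.norm_ofNat]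
  simp only [norm_mul, norm_neg, norm_I, mul_one] at h1 h2
  linarith

theorem sharp_sin : HoldsWithSharpBound (fun z => 1 + sin z)
    (Real.exp 1 *
      ∑' n : ℕ, (-1 : ℝ) ^ n / ((Nat.factorial (2 * n + 1) : ℝ) * (2 * (n : ℝ) + 1))) := by
  have hd : ∀ r ∈ Set.Ioo (-2 : ℝ) 2, HasDerivAt (fun x : ℝ => ∑' n : ℕ, (-1) ^ n * x ^ (2 * n + 1)
        / ((Nat.factorial (2 * n + 1) : ℝ) * (((2 * n : ℕ) : ℝ) + 1)))
      (∑' n : ℕ, (-1) ^ n * r ^ (2 * n) / (Nat.factorial (2 * n + 1) : ℝ)) r := fun r hr =>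
    hasDerivAt_tsum_pow_div_factorial (a := fun n => (-1) ^ n) (m := fun n => 2 * n)
      (fun n => by simp) summable_two_pow_odd_div_factorial hr
  have hc := continuousOn_of_hasDerivAt_Ioo hd
  have hd' : ∀ r ∈ Set.Ioo (0 : ℝ) 1, HasDerivAt (fun x : ℝ => ∑' n : ℕ, (-1) ^ n * x ^ (2 * n + 1)
        / ((Nat.factorial (2 * n + 1) : ℝ) * (((2 * n : ℕ) : ℝ) + 1))) (Real.sin r / r) r := by
    intro r hr
    refine (hd r ⟨by linarith [hr.1], by linarith [hr.2]⟩).congr_deriv ?_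
    rw [Real.sin_eq_tsum, ← tsum_div_const]
    refine tsum_congr fun n => ?_
    have := hr.1.ne'
    rw [pow_succ]
    field_simp
  -- 17/18 is the integral over [0, 1] of 1 - r²/6 ≤ sin r / r; 17e/18 exceeds Φ(1) = 2.
  have h1 : (17 / 18 : ℝ) ≤ ∑' n : ℕ, (-1) ^ n * (1 : ℝ) ^ (2 * n + 1)
        / ((Nat.factorial (2 * n + 1) : ℝ) * (((2 * n : ℕ) : ℝ) + 1)) := by
    have := value_at_one_le hc hd' (Χ := fun r => r - r ^ 3 / 18) (χ := fun r => 1 - r ^ 2 / 6)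
      (by fun_prop) (fun r _ => by
        refine ((hasDerivAt_id r).sub (((hasDerivAt_id r).pow 3).div_const 18)).congr_deriv ?_
        simp only [id]
        ring) (by simp) (fun r hr => by
        rw [le_div_iff₀ hr.1]
        nlinarith [Real.sin_ge_sub_cube hr.1.le])
    norm_num at this ⊢
    exact this
  have hsinc : ∀ r ∈ Set.Ioo (0 : ℝ) 1, r * (Real.sin r / r) = Real.sin r := fun r hr =>
    mul_div_cancel₀ _ hr.1.ne'
  have key : (∑' n : ℕ, (-1 : ℝ) ^ n / ((Nat.factorial (2 * n + 1) : ℝ) * (2 * (n : ℝ) + 1)))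
      = ∑' n : ℕ, (-1) ^ n * (1 : ℝ) ^ (2 * n + 1)
        / ((Nat.factorial (2 * n + 1) : ℝ) * (((2 * n : ℕ) : ℝ) + 1)) := by
    simp
  refine holdsWithSharpBound_of_radial_bounds ?_ (by simp) _ _ (fun r => 2 * r) (fun _ => 2)
    (congrArg _ key) hc (by simp) hd' ?_ ?_ ?_ (by fun_prop) (by simp)
    (fun r _ => by simpa using (hasDerivAt_id r).const_mul 2) ?_ ?_
  · exact DifferentiableOn.analyticOnNhd (by fun_prop) isOpen_unitDisk
  · intro r hr
    exact div_pos (Real.sin_pos_of_pos_of_lt_pi hr.1 (by linarith [hr.2, Real.pi_gt_three])) hr.1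
  · intro r hr
    rw [← ofReal_mul, hsinc r hr, sin_neg, ofReal_sin]
    ring
  · intro w hw him r hr hwr
    have hre := abs_lt.1 (abs_re_lt_one hw)
    have hpi := Real.pi_gt_three
    -- This is Im sin w. As |Re w| < 1 < π/2 the cosine is positive, so w is real, where sine is
    -- increasing.
    have h2 : Real.cos w.re * Real.sinh w.im = 0 := by
      have h3 := congrArg im (sin_eq w)
      rw [add_im, one_im, zero_add] at him
      rw [← ofReal_sin, ← ofReal_cos, ← ofReal_cosh, ← ofReal_sinh, ← ofReal_mul, ← ofReal_mul,
        him] at h3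
      simp only [add_im, ofReal_im, mul_I_im, ofReal_re, zero_add] at h3
      exact h3.symm
    have h3 : w.im = 0 := by
      rcases mul_eq_zero.1 h2 with h | h
      · exact absurd h (Real.cos_pos_of_mem_Ioo ⟨by linarith, by linarith⟩).ne'
      · exact Real.sinh_eq_zero.1 h
    obtain ⟨x, rfl⟩ : ∃ x : ℝ, w = x := ⟨w.re, Complex.ext rfl h3⟩
    have hx := neg_le_of_norm_ofReal_le hwr
    rw [ofReal_re] at hre
    have h4 : Real.sin (-r) ≤ Real.sin x := Real.sin_le_sin_of_le_of_le_pi_div_two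
      (by linarith [hr.2]) (by linarith) hx
    rw [hsinc r hr, ← ofReal_sin, add_re, one_re, ofReal_re]
    rw [Real.sin_neg] at h4
    linarith
  · intro w hw r _ hwr
    rw [add_sub_cancel_left]
    refine (norm_csin_le (mem_unitDisk.1 hw).le).trans ?_
    linarith
  · rw [key]
    have := exp_one_bounds.1
    nlinarith

theorem sharp_exp : HoldsWithSharpBound (fun z => exp z)
    (Real.exp 1 *
      ∑' n : ℕ, (-1 : ℝ) ^ (n + 2) / ((Nat.factorial (n + 1) : ℝ) * ((n : ℝ) + 1))) := by
  have hd : ∀ r ∈ Set.Ioo (-2 : ℝ) 2, HasDerivAt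
      (fun x : ℝ => ∑' n : ℕ, (-1) ^ (n + 2) * x ^ (n + 1)
        / ((Nat.factorial (n + 1) : ℝ) * ((n : ℝ) + 1)))
      (∑' n : ℕ, (-1) ^ (n + 2) * r ^ n / (Nat.factorial (n + 1) : ℝ)) r := fun r hr =>
    hasDerivAt_tsum_pow_div_factorial (a := fun n => (-1) ^ (n + 2)) (m := fun n => n)
      (fun n => by simp) summable_two_pow_succ_div_factorial hr
  have hc := continuousOn_of_hasDerivAt_Ioo hd
  have hd' : ∀ r ∈ Set.Ioo (0 : ℝ) 1, HasDerivAt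
      (fun x : ℝ => ∑' n : ℕ, (-1) ^ (n + 2) * x ^ (n + 1)
        / ((Nat.factorial (n + 1) : ℝ) * ((n : ℝ) + 1))) ((1 - Real.exp (-r)) / r) r := by
    intro r hr
    refine (hd r ⟨by linarith [hr.1], by linarith [hr.2]⟩).congr_deriv ?_
    have hr0 := hr.1.ne'
    have hs : HasSum (fun n : ℕ => (-r) ^ n / (Nat.factorial n : ℝ)) (Real.exp (-r)) := by
      rw [Real.exp_eq_exp_ℝ]
      exact NormedSpace.expSeries_div_hasSum_exp (-r)
    have h1 := ((hasSum_nat_add_iff' 1).2 hs).div_const (-r)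
    simp only [Finset.range_one, Finset.sum_singleton, pow_zero, Nat.factorial_zero, Nat.cast_one,
      div_one] at h1
    have h2 : (1 - Real.exp (-r)) / r = (Real.exp (-r) - 1) / -r := by
      rw [div_neg, ← neg_div, neg_sub]
    rw [h2, ← h1.tsum_eq]
    refine tsum_congr fun n => ?_
    rw [pow_succ (-r) n, neg_pow r n]
    field_simp
    ring
  -- 3/4 is the integral over [0, 1] of 1 - r/2 ≤ (1 - e^(-r))/r; 3e/4 just exceeds Φ(1) = 2.
  have h1 : (3 / 4 : ℝ) ≤ ∑' n : ℕ, (-1) ^ (n + 2) * (1 : ℝ) ^ (n + 1)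
        / ((Nat.factorial (n + 1) : ℝ) * ((n : ℝ) + 1)) := by
    have := value_at_one_le hc hd' (Χ := fun r => r - r ^ 2 / 4) (χ := fun r => 1 - r / 2)
      (by fun_prop) (fun r _ => by
        refine ((hasDerivAt_id r).sub (((hasDerivAt_id r).pow 2).div_const 4)).congr_deriv ?_
        simp only [id]
        ring) (by simp) (fun r hr => by
        have h2 := Real.quadratic_le_exp_of_nonneg hr.1.le
        have h3 : Real.exp (-r) ≤ 1 - r + r ^ 2 / 2 := by
          rw [Real.exp_neg, inv_le_iff_one_le_mul₀ (Real.exp_pos r)]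
          have h4 : 0 ≤ 1 - r + r ^ 2 / 2 := by nlinarith [sq_nonneg (1 - r)]
          nlinarith [mul_le_mul_of_nonneg_left h2 h4, pow_nonneg hr.1.le 4]
        rw [le_div_iff₀ hr.1]
        linarith)
    norm_num at this ⊢
    exact this
  have hrexp : ∀ r ∈ Set.Ioo (0 : ℝ) 1, r * ((1 - Real.exp (-r)) / r) = 1 - Real.exp (-r) :=
    fun r hr => mul_div_cancel₀ _ hr.1.ne'
  have key : (∑' n : ℕ, (-1 : ℝ) ^ (n + 2) / ((Nat.factorial (n + 1) : ℝ) * ((n : ℝ) + 1)))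
      = ∑' n : ℕ, (-1) ^ (n + 2) * (1 : ℝ) ^ (n + 1)
        / ((Nat.factorial (n + 1) : ℝ) * ((n : ℝ) + 1)) := by
    simp
  refine holdsWithSharpBound_of_radial_bounds ?_ (by simp) _ _ (fun r => 2 * r) (fun _ => 2)
    (congrArg _ key) hc (by simp) hd' ?_ ?_ ?_ (by fun_prop) (by simp)
    (fun r _ => by simpa using (hasDerivAt_id r).const_mul 2) ?_ ?_
  · exact DifferentiableOn.analyticOnNhd (by fun_prop) isOpen_unitDisk
  · intro r hr
    refine div_pos (sub_pos.2 ?_) hr.1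
    rw [Real.exp_lt_one_iff]
    linarith [hr.1]
  · intro r hr
    rw [← ofReal_mul, hrexp r hr]
    push_cast
    ring
  · intro w hw him r hr hwr
    have hpi := Real.pi_gt_three
    have him' := abs_lt.1 ((abs_im_le_norm w).trans_lt (mem_unitDisk.1 hw))
    rw [exp_im] at him
    -- A real value of e^w needs sin(Im w) = 0, and |Im w| < 1 < π.
    have h2 : w.im = 0 := (Real.sin_eq_zero_iff_of_lt_of_lt (by linarith) (by linarith)).1
      ((mul_eq_zero.1 him).resolve_left (Real.exp_pos _).ne')
    have h3 := (abs_le.1 (abs_re_le_norm w)).1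
    rw [hrexp r hr, exp_re, h2, Real.cos_zero, mul_one, sub_sub_cancel]
    exact Real.exp_le_exp.2 (by linarith)
  · intro w hw r _ hwr
    refine (norm_exp_sub_one_le (mem_unitDisk.1 hw).le).trans ?_
    linarith
  · rw [key]
    have := exp_one_bounds.1
    nlinarith

end CardioidSubordination

theorem mainTheorem11 :
    -- the function `phi0`
    CardioidSubordination.HoldsWithSharpBound CardioidSubordination.phi0
      (Real.exp 1 * (-1 + 2 * CardioidSubordination.k * Real.log (1 + 1 / CardioidSubordination.k))
        / CardioidSubordination.k) ∧
    -- the lemniscate function `√(1 + z)`, principal branch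
    CardioidSubordination.HoldsWithSharpBound (fun z => Complex.sqrt (1 + z))
      (2 * Real.exp 1 * (1 - Real.log 2)) ∧
    -- the functions `1 + z / (1 - α z²)`
    (∀ α : ℝ, 0 < α → α < 1 →
      CardioidSubordination.HoldsWithSharpBound (fun z => 1 + z / (1 - (α : ℂ) * z ^ 2))
        (Real.exp 1 * Real.log ((1 + Real.sqrt α) / (1 - Real.sqrt α)) / (2 * Real.sqrt α))) ∧
    -- the Janowski functions `(1 + A z) / (1 + B z)`
    (∀ A B : ℝ, 0 < B → B < A → A < 1 →
      CardioidSubordination.HoldsWithSharpBound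
        (fun z => (1 + (A : ℂ) * z) / (1 + (B : ℂ) * z))
        (max (Real.exp 1 * (A - B) / B * Real.log (1 / (1 - B)))
          ((A - B) / (Real.exp 1 * B) * Real.log (1 + B)))) ∧
    -- the function `1 + sin z`
    CardioidSubordination.HoldsWithSharpBound (fun z => 1 + Complex.sin z)
      (Real.exp 1 *
        ∑' n : ℕ, (-1 : ℝ) ^ n / ((Nat.factorial (2 * n + 1) : ℝ) * (2 * (n : ℝ) + 1))) ∧
    -- the crescent function `z + √(1 + z²)`, principal branch
    CardioidSubordination.HoldsWithSharpBound (fun z => z + Complex.sqrt (1 + z ^ 2))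
      (Real.exp 1 * (3 - CardioidSubordination.k + Real.log (CardioidSubordination.k / 2))) ∧
    -- the exponential function; the series over `n ≥ 1` is indexed by `n + 1`
    CardioidSubordination.HoldsWithSharpBound (fun z => Complex.exp z)
      (Real.exp 1 *
        ∑' n : ℕ, (-1 : ℝ) ^ (n + 2) / ((Nat.factorial (n + 1) : ℝ) * ((n : ℝ) + 1))) := by
  open CardioidSubordination in
  exact ⟨sharp_phi0, sharp_sqrt, fun _ h h1 => sharp_booth h h1,
    fun _ _ hB hAB hA => sharp_janowski hB hAB hA, sharp_sin, sharp_crescent, sharp_exp⟩
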